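/- **Calculus.** Fix a set of region names $r,s,\dots$; $e,e',\dots$ range over finite sets of regions. Types are $A::=\mathbf 1\mid \mathsf{Reg}_rA\mid (A\xrightarrow{e}A)$. Terms (up to renaming of bound variables) are $M::=x\mid r\mid *\mid\lambda x.M\mid MM\mid \mathsf{get}(M)\mid\mathsf{set}(M,M)$, and values are $V::=r\mid *\mid\lambda x.M$. A region context $R=r_1:A_1,\dots,r_n:A_n$ is a finite sequence with $\mathrm{dom}(R)=\{r_1,\dots,r_n\}$; a context $\Gamma=x_1:A_1,\dots,x_n:A_n$ assigns types to distinct variables. A store $S$ has a finite domain $\mathrm{dom}(S)$ of regions and binds each $r\in\mathrm{dom}(S)$ to a (possibly infinite) set $S(r)$ of values. Evaluation contexts are $E::=[\,]\mid EM\mid VE\mid\mathsf{get}(E)\mid\mathsf{set}(E,M)\mid\mathsf{set}(V,E)$. Single-threaded programs $M,S$ reduce by $$E[(\lambda x.M)V],S\to E[[V/x]M],S;\qquad E[\mathsf{get}(r)],S\to E[V],S\ \text{ if } V\in S(r);\qquad E[\mathsf{set}(r,V)],S\to E[*],(S,r\Leftarrow V),$$ where $S,r\Leftarrow V$ is $S$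 with $V$ added to the values bound to $r$. $\mathrm{SN}$ is the set of programs $M,S$ all of whose reduction sequences terminate, and $(M,S)\Downarrow(M',S')$ means that $M,S\to^*M',S'$ and $M',S'$ does not reduce. **Stratified type and effect system.** The judgements $R\vdash$, $R\vdash A$ and $R\vdash(A,e)$ are defined inductively: $\emptyset\vdash$; $R,r:A\vdash$ if $R\vdash A$ and $r\notin\mathrm{dom}(R)$; $R\vdash\mathbf 1$ if $R\vdash$; $R\vdash\mathsf{Reg}_rA$ if $R\vdash$ and $r:A\in R$; $R\vdash A\xrightarrow{e}B$ if $R\vdash A$, $R\vdash B$ and $e\subseteq\mathrm{dom}(R)$; $R\vdash (A,e)$ if $R\vdash A$ and $e\subseteq\mathrm{dom}(R)$. $R\vdash\Gamma$ means $R\vdash$ and $R\vdash A$ for each type $A$ in $\Gamma$. Subtyping: $R\vdash A\le A$ if $R\vdash A$; $R\vdash(A\xrightarrow{e}B)\le(A'\xrightarrow{e'}B')$ if $R\vdash A'\le A$, $R\vdash B\le B'$ and $e\subseteq e'\subseteq\mathrm{dom}(R)$; $R\vdash(A,e)\le(A',e')$ if $R\vdash A\le A'$ and $e\subseteq e'\subseteq\mathrm{dom}(R)$.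 Typing is given by the rules: - if $R\vdash\Gamma$: $R;\Gamma\vdash x:(A,\emptyset)$ when $x:A\in\Gamma$; $R;\Gamma\vdash r:(\mathsf{Reg}_rA,\emptyset)$ when $r:A\in R$; $R;\Gamma\vdash *:(\mathbf 1,\emptyset)$; - if $R;\Gamma,x:A\vdash M:(B,e)$ then $R;\Gamma\vdash\lambda x.M:(A\xrightarrow{e}B,\emptyset)$; - if $R;\Gamma\vdash M:(A\xrightarrow{e_2}B,e_1)$ and $R;\Gamma\vdash N:(A,e_3)$ then $R;\Gamma\vdash MN:(B,e_1\cup e_2\cup e_3)$; - if $R;\Gamma\vdash M:(\mathsf{Reg}_rA,e)$ then $R;\Gamma\vdash\mathsf{get}(M):(A,e\cup\{r\})$; - if $R;\Gamma\vdash M:(\mathsf{Reg}_rA,e_1)$ and $R;\Gamma\vdash N:(A,e_2)$ then $R;\Gamma\vdash\mathsf{set}(M,N):(\mathbf 1,e_1\cup e_2\cup\{r\})$; - if $R;\Gamma\vdash M:(A,e)$ and $R\vdash(A,e)\le(A',e')$ then $R;\Gamma\vdash M:(A',e')$. **Interpretation.** Write $R'\ge R$ if $R'\vdash$ and $R'=R,R''$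 for some $R''$. For $R\vdash$ and $R'\ge R$, the saturated store $[\![R]\!](R')$ is the store $S$ with $\mathrm{dom}(S)=\mathrm{dom}(R)$ and $S(r)=\{V \text{ value}\mid R'\vdash V\in[\![R_1\vdash(A,\emptyset)]\!]\}$ whenever $R=R_1,r:A,R_2$. For $R\vdash(A,e)$, $[\![R\vdash(A,e)]\!]$ is the set of pairs $R'\vdash M$ such that 1. $R'\ge R$ and $R';\emptyset\vdash M:(A,e)$; 2. for all $R''\ge R'$, the program $M,[\![R]\!](R'')$ is in $\mathrm{SN}$; 3. for all $R''\ge R'$ and $M',S'$, if $(M,[\![R]\!](R''))\Downarrow(M',S')$ then $S'=[\![R]\!](R'')$, and: if $A=\mathbf 1$ then $M'=*$; if $A=\mathsf{Reg}_rB$ then $M'=r$; if $A=A_1\xrightarrow{e'}A_2$ then $M'$ is a $\lambda$-abstraction and, for all $R_1\ge R''$ and all values $V$, $R_1\vdash V\in[\![R\vdash(A_1,\emptyset)]\!]$ implies $R_1\vdash M'V\in[\![R\vdash(A_2,e')]\!]$. (These two notions are defined together, by induction on the judgements $R\vdash$ and $R\vdash(A,e)$.) Finally, $R;x_1:A_1,\dots,x_n:A_n\models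 M:(B,e)$ means: for all $R'\ge R$ and all values $V_1,\dots,V_n$ with $R'\vdash V_i\in[\![R\vdash(A_i,\emptyset)]\!]$ for $i=1,\dots,n$, one has $R'\vdash[V_1/x_1,\dots,V_n/x_n]M\in[\![R\vdash(B,e)]\!]$. **Theorem (soundness).** If $R;\Gamma\vdash M:(B,e)$ then $R;\Gamma\models M:(B,e)$. -/

import Mathlib

namespace StratRegions

/-- Types `1`, `Reg_r A` and `A -e-> B`, over a set `ρ` of region names. -/
inductive Ty (ρ : Type*) where
  | one : Ty ρ
  | reg (r : ρ) (A : Ty ρ) : Ty ρ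
  | arr (A : Ty ρ) (e : Finset ρ) (B : Ty ρ) : Ty ρ

/-- Terms up to renaming of bound variables (de Bruijn indices). -/
inductive Tm (ρ : Type*) where
  | var (i : ℕ) : Tm ρ
  | region (r : ρ) : Tm ρ
  | star : Tm ρ
  | lam (M : Tm ρ) : Tm ρ
  | app (M N : Tm ρ) : Tm ρ
  | get (M : Tm ρ) : Tm ρ
  | set (M N : Tm ρ) : Tm ρ

/-- Region contexts `r₁ : A₁, …, rₙ : Aₙ`, written with the most recent (rightmost) entry at the
head of the list: `R, r : A` is `(r, A) :: R`, and `R, R''` is `R'' ++ R`. -/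
abbrev RegCtx (ρ : Type*) := List (ρ × Ty ρ)

/-- Variable contexts; the variable with de Bruijn index `i` has the `i`-th type of the list, so
that `Γ, x : A` is `A :: Γ`. -/
abbrev Ctx (ρ : Type*) := List (Ty ρ)

section

variable {ρ : Type*}

/-! ### Substitution and values -/

/-- Extension of a renaming under a binder. -/
def upRen (f : ℕ → ℕ) : ℕ → ℕ
  | 0 => 0
  | i + 1 => f i + 1

/-- Renaming of free variables. -/
def Tm.rename (f : ℕ → ℕ) : Tm ρ → Tm ρ
  | .var i => .var (f i)
  | .region r => .region r
  | .star => .star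
  | .lam M => .lam (M.rename (upRen f))
  | .app M N => .app (M.rename f) (N.rename f)
  | .get M => .get (M.rename f)
  | .set M N => .set (M.rename f) (N.rename f)

/-- Extension of a substitution under a binder. -/
def upSubst (σ : ℕ → Tm ρ) : ℕ → Tm ρ
  | 0 => .var 0
  | i + 1 => (σ i).rename Nat.succ

/-- Simultaneous capture-avoiding substitution. -/
def Tm.subst (σ : ℕ → Tm ρ) : Tm ρ → Tm ρ
  | .var i => σ i
  | .region r => .region r
  | .star => .star
  | .lam M => .lam (M.subst (upSubst σ))
  | .app M N => .app (M.subst σ) (N.subst σ)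
  | .get M => .get (M.subst σ)
  | .set M N => .set (M.subst σ) (N.subst σ)

/-- The substitution `[V₀/0, …, Vₙ₋₁/n-1]`, which removes the first `n` variables. -/
def listSubst (Vs : List (Tm ρ)) (i : ℕ) : Tm ρ :=
  (Vs[i]?).getD (.var (i - Vs.length))

/-- `[V/x]M`, where `x` is the variable `0` of `M`. -/
def Tm.inst (M V : Tm ρ) : Tm ρ := M.subst (listSubst [V])

/-- Values `V ::= r | * | λx.M`. -/
inductive Tm.IsValue : Tm ρ → Prop
  | region (r : ρ) : Tm.IsValue (.region r)
  | star : Tm.IsValue .star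
  | lam (M : Tm ρ) : Tm.IsValue (.lam M)

/-! ### Stratified type and effect system -/

variable [DecidableEq ρ]

/-- The domain of a region context. -/
def RegCtx.dom (R : RegCtx ρ) : Finset ρ := (R.map Prod.fst).toFinset

mutual

/-- `R ⊢`: the region context is well formed (stratified). -/
inductive WfReg : RegCtx ρ → Prop
  | nil : WfReg []
  | cons {R : RegCtx ρ} {r : ρ} {A : Ty ρ} :
      WfTy R A → r ∉ RegCtx.dom R → WfReg ((r, A) :: R)

/-- `R ⊢ A`: the type is well formed in the region context (stratified). -/
inductive WfTy : RegCtx ρ → Ty ρ → Prop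
  | one {R : RegCtx ρ} : WfReg R → WfTy R .one
  | reg {R : RegCtx ρ} {r : ρ} {A : Ty ρ} : WfReg R → (r, A) ∈ R → WfTy R (.reg r A)
  | arr {R : RegCtx ρ} {A B : Ty ρ} {e : Finset ρ} :
      WfTy R A → WfTy R B → e ⊆ RegCtx.dom R → WfTy R (.arr A e B)

end

/-- `R ⊢ Γ`. -/
def WfCtx (R : RegCtx ρ) (Γ : Ctx ρ) : Prop := WfReg R ∧ ∀ A ∈ Γ, WfTy R A

/-- `R ⊢ A ≤ A'`. -/
inductive SubTy (R : RegCtx ρ) : Ty ρ → Ty ρ → Prop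
  | refl {A : Ty ρ} : WfTy R A → SubTy R A A
  | arr {A A' B B' : Ty ρ} {e e' : Finset ρ} :
      SubTy R A' A → SubTy R B B' → e ⊆ e' → e' ⊆ RegCtx.dom R →
      SubTy R (.arr A e B) (.arr A' e' B')

/-- `R ⊢ (A, e) ≤ (A', e')`. -/
def SubTyEff (R : RegCtx ρ) (A : Ty ρ) (e : Finset ρ) (A' : Ty ρ) (e' : Finset ρ) : Prop :=
  SubTy R A A' ∧ e ⊆ e' ∧ e' ⊆ RegCtx.dom R

/-- The typing judgement `R; Γ ⊢ M : (A, e)`. -/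
inductive HasType (R : RegCtx ρ) : Ctx ρ → Tm ρ → Ty ρ → Finset ρ → Prop
  | var {Γ : Ctx ρ} {i : ℕ} {A : Ty ρ} :
      WfCtx R Γ → Γ[i]? = some A → HasType R Γ (.var i) A ∅
  | region {Γ : Ctx ρ} {r : ρ} {A : Ty ρ} :
      WfCtx R Γ → (r, A) ∈ R → HasType R Γ (.region r) (.reg r A) ∅
  | star {Γ : Ctx ρ} : WfCtx R Γ → HasType R Γ .star .one ∅
  | lam {Γ : Ctx ρ} {M : Tm ρ} {A B : Ty ρ} {e : Finset ρ} :
      HasType R (A :: Γ) M B e → HasType R Γ (.lam M) (.arr A e B) ∅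
  | app {Γ : Ctx ρ} {M N : Tm ρ} {A B : Ty ρ} {e₁ e₂ e₃ : Finset ρ} :
      HasType R Γ M (.arr A e₂ B) e₁ → HasType R Γ N A e₃ →
      HasType R Γ (.app M N) B (e₁ ∪ e₂ ∪ e₃)
  | get {Γ : Ctx ρ} {M : Tm ρ} {r : ρ} {A : Ty ρ} {e : Finset ρ} :
      HasType R Γ M (.reg r A) e → HasType R Γ (.get M) A (e ∪ {r})
  | set {Γ : Ctx ρ} {M N : Tm ρ} {r : ρ} {A : Ty ρ} {e₁ e₂ : Finset ρ} :
      HasType R Γ M (.reg r A) e₁ → HasType R Γ N A e₂ →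
      HasType R Γ (.set M N) .one (e₁ ∪ e₂ ∪ {r})
  | sub {Γ : Ctx ρ} {M : Tm ρ} {A A' : Ty ρ} {e e' : Finset ρ} :
      HasType R Γ M A e → SubTyEff R A e A' e' → HasType R Γ M A' e'

/-! ### Stores and reduction -/

/-- A store: a finite domain of regions, each bound to a (possibly infinite) set of values. -/
structure Store (ρ : Type*) where
  dom : Finset ρ
  contents : ρ → Set (Tm ρ)
  isValue : ∀ r, ∀ V ∈ contents r, V.IsValue
  mem_dom : ∀ r, ∀ V ∈ contents r, r ∈ dom

/-- The empty store. -/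
def Store.empty : Store ρ where
  dom := ∅
  contents := fun _ => ∅
  isValue := fun _ _ h => h.elim
  mem_dom := fun _ _ h => h.elim

/-- The store `S, r ⇐ v`; the values already bound to `r` are kept. -/
def Store.add (S : Store ρ) (r : ρ) (v : Set (Tm ρ)) (hv : ∀ V ∈ v, V.IsValue) : Store ρ where
  dom := insert r S.dom
  contents := fun s => {V | V ∈ S.contents s ∨ (s = r ∧ V ∈ v)}
  isValue := by
    rintro s V (h | ⟨-, h⟩)
    · exact S.isValue s V h
    · exact hv V h
  mem_dom := by
    rintro s V (h | ⟨rfl, -⟩)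
    · exact Finset.mem_insert_of_mem (S.mem_dom s V h)
    · exact Finset.mem_insert_self _ _

/-- Call-by-value evaluation contexts. -/
inductive ECtx (ρ : Type*) where
  | hole : ECtx ρ
  | appL (E : ECtx ρ) (M : Tm ρ) : ECtx ρ
  | appR (V : Tm ρ) (hV : V.IsValue) (E : ECtx ρ) : ECtx ρ
  | get (E : ECtx ρ) : ECtx ρ
  | setL (E : ECtx ρ) (M : Tm ρ) : ECtx ρ
  | setR (V : Tm ρ) (hV : V.IsValue) (E : ECtx ρ) : ECtx ρ

/-- `E[M]`. -/
def ECtx.fill : ECtx ρ → Tm ρ → Tm ρ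
  | .hole, M => M
  | .appL E N, M => .app (E.fill M) N
  | .appR V _ E, M => .app V (E.fill M)
  | .get E, M => .get (E.fill M)
  | .setL E N, M => .set (E.fill M) N
  | .setR V _ E, M => .set V (E.fill M)

/-- Reduction of single-threaded programs `M, S`. -/
inductive Step : Tm ρ × Store ρ → Tm ρ × Store ρ → Prop
  | beta (E : ECtx ρ) (M V : Tm ρ) (S : Store ρ) : V.IsValue →
      Step (E.fill (.app (.lam M) V), S) (E.fill (M.inst V), S)
  | get (E : ECtx ρ) (r : ρ) (V : Tm ρ) (S : Store ρ) : V ∈ S.contents r →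
      Step (E.fill (.get (.region r)), S) (E.fill V, S)
  | set (E : ECtx ρ) (r : ρ) (V : Tm ρ) (S : Store ρ) (hV : V.IsValue) :
      Step (E.fill (.set (.region r) V), S)
        (E.fill .star, S.add r {V} (fun _ h => Set.mem_singleton_iff.mp h ▸ hV))

/-- Strong normalisation: every reduction sequence from `P` is finite. -/
def SN (P : Tm ρ × Store ρ) : Prop := Acc (fun Q' Q => Step Q Q') P

/-- `P ⇓ Q`: `P` reduces in some number of steps to `Q`, which does not reduce. -/
def Conv (P Q : Tm ρ × Store ρ) : Prop :=
  Relation.ReflTransGen Step P Q ∧ ¬ ∃ Q', Step Q Q'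

/-! ### Interpretation -/

/-- `R' ≥ R`: `R' ⊢` and `R' = R, R''` for some `R''`. -/
def Extends (R' R : RegCtx ρ) : Prop := WfReg R' ∧ ∃ R'' : RegCtx ρ, R' = R'' ++ R

/-- The set of pairs `R' ⊢ M` satisfying the conditions (1)-(3) of the interpretation of
`R ⊢ (A, e)`, for a given saturated store `sat R''` in each extension `R''` of `R`, and a given
condition `C R'' M'` on the normal forms `M'`. -/
def Candidate (R : RegCtx ρ) (sat : RegCtx ρ → Store ρ) (A : Ty ρ) (e : Finset ρ)
    (C : RegCtx ρ → Tm ρ → Prop) : Set (RegCtx ρ × Tm ρ) :=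
  {p | (Extends p.1 R ∧ HasType p.1 [] p.2 A e) ∧
    (∀ R'', Extends R'' p.1 → SN (p.2, sat R'')) ∧
    (∀ M' S' R'', Extends R'' p.1 → Conv (p.2, sat R'') (M', S') → S' = sat R'' ∧ C R'' M')}

/-- The condition `C(A, R, R'', M')`, relative to the saturated stores `sat`. -/
def NormalCond (R : RegCtx ρ) (sat : RegCtx ρ → Store ρ) : Ty ρ → RegCtx ρ → Tm ρ → Prop
  | .one, _, M' => M' = .star
  | .reg r _, _, M' => M' = .region r
  | .arr A₁ e' A₂, R'', M' => (∃ N, M' = .lam N) ∧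
      ∀ R₁ V, Extends R₁ R'' → V.IsValue →
        (R₁, V) ∈ Candidate R sat A₁ ∅ (NormalCond R sat A₁) →
        (R₁, Tm.app M' V) ∈ Candidate R sat A₂ e' (NormalCond R sat A₂)

/-- The saturated store `⟦R⟧(R')`: its domain is `dom R`, and if `R = R₁, r : A, R₂` then it binds
`r` to the set of all values `V` such that `R' ⊢ V` is in the interpretation of
`R₁ ⊢ (A, ∅)`. -/
def satStore : RegCtx ρ → RegCtx ρ → Store ρ
  | [], _ => Store.empty
  | (r, A) :: R, R' => (satStore R R').add r
      {V | V.IsValue ∧ (R', V) ∈ Candidate R (satStore R) A ∅ (NormalCond R (satStore R) A)}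
      (fun _ h => h.1)

/-- The interpretation `⟦R ⊢ (A, e)⟧`, a set of pairs `R' ⊢ M`. -/
def Interp (R : RegCtx ρ) (A : Ty ρ) (e : Finset ρ) : Set (RegCtx ρ × Tm ρ) :=
  Candidate R (satStore R) A e (NormalCond R (satStore R) A)

/-- Semantic validity `R; Γ ⊨ M : (B, e)`. -/
def Valid (R : RegCtx ρ) (Γ : Ctx ρ) (M : Tm ρ) (B : Ty ρ) (e : Finset ρ) : Prop :=
  ∀ (R' : RegCtx ρ) (Vs : List (Tm ρ)), Extends R' R →
    List.Forall₂ (fun V A => V.IsValue ∧ (R', V) ∈ Interp R A ∅) Vs Γ →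
    (R', M.subst (listSubst Vs)) ∈ Interp R B e

end

end StratRegions

/-!
The proof is a logical-relations argument by induction on typing derivations. A store only grows
during reduction, so a program that always ends in the store `⟦R⟧(R'')` from which it started
never changes that store. Termination, preservation of the store and the condition on normal forms
are therefore merged into one inductive predicate `Converges S Q M` for a fixed store `S`, which
composes along the frames of evaluation contexts (`Converges.bind`).

The difficulty is in `get` and `set`. If `R = R₁, r : A, R₂`, the saturated store binds `r` to the
values in the interpretation of `A` over `R₁`, while the typing rules speak about `A` over `R`.
The two interpretations agree (`mem_interp_iff_of_extends`): a term of effect `e ⊆ dom R₁` accesses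
only regions of `e` (`HasType.red_of_agree`), on which `⟦R⟧(R'')` and `⟦R₁⟧(R'')` have the same
contents, and it keeps its type and effect when it reduces (`HasType.preservation`).
Hence the contents of `r` are the values in the interpretation of `A` over `R`
(`mem_satStore_iff`). It follows that a value that is read is in the interpretation, and that
writing a value of the interpretation leaves the saturated store unchanged. A read never gets
stuck, since every well-formed type contains a value (`inhabitant_mem_interp`).
-/

namespace StratRegions

variable {ρ : Type*}

/-! ### Renaming and substitution -/

namespace Tm

theorem rename_subst (M : Tm ρ) (f : ℕ → ℕ) (σ : ℕ → Tm ρ) :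
    (M.rename f).subst σ = M.subst (fun i => σ (f i)) := by
  induction M generalizing f σ with
  | lam M ih =>
    simp only [rename, subst, ih]
    congr 2
    funext i
    cases i <;> rfl
  | _ => simp_all [rename, subst]

theorem rename_rename (M : Tm ρ) (f g : ℕ → ℕ) :
    (M.rename f).rename g = M.rename (fun i => g (f i)) := by
  induction M generalizing f g with
  | lam M ih =>
    simp only [rename, ih]
    congr 2
    funext i
    cases i <;> rfl
  | _ => simp_all [rename]

theorem subst_rename (M : Tm ρ) (σ : ℕ → Tm ρ) (g : ℕ → ℕ) :
    (M.subst σ).rename g = M.subst (fun i => (σ i).rename g) := by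
  induction M generalizing σ g with
  | lam M ih =>
    simp only [rename, subst, ih]
    congr 2
    funext i
    cases i with
    | zero => rfl
    | succ i => simp only [upSubst, rename_rename, upRen]
  | _ => simp_all [rename, subst]

theorem subst_subst (M : Tm ρ) (σ τ : ℕ → Tm ρ) :
    (M.subst σ).subst τ = M.subst (fun i => (σ i).subst τ) := by
  induction M generalizing σ τ with
  | lam M ih =>
    simp only [subst, ih]
    congr 2
    funext i
    cases i with
    | zero => rfl
    | succ i => simp only [upSubst, rename_subst, subst_rename]
  | _ => simp_all [subst]

theorem subst_var (M : Tm ρ) : M.subst var = M := by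
  induction M with
  | lam M ih =>
    have h : upSubst (var : ℕ → Tm ρ) = var := by
      funext i
      cases i <;> rfl
    simp only [subst, h, ih]
  | _ => simp_all [subst]

/-- Opening the body of a substituted abstraction extends the substitution by one term. -/
theorem inst_subst_upSubst (M V : Tm ρ) (Vs : List (Tm ρ)) :
    (M.subst (upSubst (listSubst Vs))).inst V = M.subst (listSubst (V :: Vs)) := by
  rw [inst, subst_subst]
  congr 1
  funext i
  cases i with
  | zero => simp [upSubst, subst, listSubst]
  | succ i =>
    have h : (fun i => listSubst [V] (Nat.succ i)) = var := by
      funext j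
      simp [listSubst]
    rw [upSubst, rename_subst, h, subst_var]
    simp [listSubst]

end Tm

/-- A closed value of each type; at arrow types it is a constant function. -/
def inhabitant : Ty ρ → Tm ρ
  | .one => .star
  | .reg r _ => .region r
  | .arr _ _ B => .lam (inhabitant B)

theorem inhabitant_isValue (A : Ty ρ) : (inhabitant A).IsValue := by
  cases A with
  | one => exact .star
  | reg r => exact .region r
  | arr => exact .lam _

theorem inhabitant_subst (A : Ty ρ) (σ : ℕ → Tm ρ) :
    (inhabitant A).subst σ = inhabitant A := by
  induction A generalizing σ with
  | one => rfl
  | reg => rfl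
  | arr A e B _ ihB => simp [inhabitant, Tm.subst, ihB]

theorem Store.ext' {S T : Store ρ} (hd : S.dom = T.dom) (hc : S.contents = T.contents) :
    S = T := by
  cases S; cases T; cases hd; cases hc; rfl

/-! ### Well-formed contexts, types and typing derivations -/

variable [DecidableEq ρ]

theorem RegCtx.mem_dom {R : RegCtx ρ} {r : ρ} : r ∈ RegCtx.dom R ↔ ∃ A, (r, A) ∈ R := by
  simp [RegCtx.dom]

theorem Extends.refl {R : RegCtx ρ} (h : WfReg R) : Extends R R := ⟨h, [], rfl⟩

theorem Extends.trans {R₁ R₂ R₃ : RegCtx ρ} (h : Extends R₁ R₂) (h' : Extends R₂ R₃) :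
    Extends R₁ R₃ := by
  obtain ⟨hw, L, rfl⟩ := h
  obtain ⟨-, L', rfl⟩ := h'
  exact ⟨hw, L ++ L', by simp⟩

theorem Extends.subset {R' R : RegCtx ρ} (h : Extends R' R) : R ⊆ R' := by
  obtain ⟨-, L, rfl⟩ := h
  exact List.subset_append_right L R

theorem Extends.dom_subset {R' R : RegCtx ρ} (h : Extends R' R) :
    RegCtx.dom R ⊆ RegCtx.dom R' := by
  intro r hr
  obtain ⟨A, hA⟩ := RegCtx.mem_dom.1 hr
  exact RegCtx.mem_dom.2 ⟨A, h.subset hA⟩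

theorem WfTy.wfReg {R : RegCtx ρ} {A : Ty ρ} (h : WfTy R A) : WfReg R := by
  induction A with
  | one => cases h; assumption
  | reg => cases h; assumption
  | arr A e B ihA _ => cases h with | arr hA _ _ => exact ihA hA

theorem WfTy.weaken {R' R : RegCtx ρ} {A : Ty ρ} (h : WfTy R A) (hR : Extends R' R) :
    WfTy R' A := by
  induction A with
  | one => exact .one hR.1
  | reg => cases h with | reg _ hm => exact .reg hR.1 (hR.subset hm)
  | arr A e B ihA ihB =>
    cases h with
    | arr hA hB he => exact .arr (ihA hA) (ihB hB) (he.trans hR.dom_subset)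

theorem WfReg.of_append {L R : RegCtx ρ} (h : WfReg (L ++ R)) : WfReg R := by
  induction L with
  | nil => exact h
  | cons p L ih => cases h with | cons hA _ => exact ih hA.wfReg

/-- An entry of a stratified region context is well formed over the entries before it. -/
theorem WfReg.wfTy_of_append_cons {L R : RegCtx ρ} {r : ρ} {A : Ty ρ}
    (h : WfReg (L ++ (r, A) :: R)) : WfTy R A := by
  cases h.of_append; assumption

theorem WfReg.notMem_dom_of_append {L R : RegCtx ρ} {r : ρ} (h : WfReg (L ++ R))
    (hr : r ∈ RegCtx.dom R) : r ∉ RegCtx.dom L := by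
  induction L with
  | nil => simp [RegCtx.dom]
  | cons p L ih =>
    obtain ⟨s, B⟩ := p
    cases h with
    | cons hB hs =>
      have h1 := ih hB.wfReg
      intro h2
      have h3 : r = s ∨ r ∈ RegCtx.dom L := by simpa [RegCtx.dom] using h2
      rcases h3 with rfl | h3
      · apply hs
        obtain ⟨A, hA⟩ := RegCtx.mem_dom.1 hr
        exact RegCtx.mem_dom.2 ⟨A, List.mem_append_right _ hA⟩
      · exact h1 h3

theorem WfReg.unique {R : RegCtx ρ} (h : WfReg R) {r : ρ} {A A' : Ty ρ} (hA : (r, A) ∈ R)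
    (hA' : (r, A') ∈ R) : A = A' := by
  induction R with
  | nil => simp at hA
  | cons p R ih =>
    obtain ⟨s, B⟩ := p
    cases h with
    | cons hB hs =>
      simp only [List.mem_cons, Prod.mk.injEq] at hA hA'
      rcases hA with ⟨rfl, rfl⟩ | hA <;> rcases hA' with ⟨h1, rfl⟩ | hA'
      · rfl
      · exact (hs (RegCtx.mem_dom.2 ⟨_, hA'⟩)).elim
      · subst h1
        exact (hs (RegCtx.mem_dom.2 ⟨_, hA⟩)).elim
      · exact ih hB.wfReg hA hA'

/-- A region context is an extension of the part that precedes one of its entries. -/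
theorem WfReg.extends_of_append_cons {L R : RegCtx ρ} {p : ρ × Ty ρ}
    (h : WfReg (L ++ p :: R)) : Extends (L ++ p :: R) R :=
  ⟨h, L ++ [p], by simp⟩

theorem WfReg.wfTy_of_mem {R : RegCtx ρ} {r : ρ} {A : Ty ρ} (h : WfReg R) (hm : (r, A) ∈ R) :
    WfTy R A := by
  obtain ⟨L, R₁, rfl⟩ := List.append_of_mem hm
  exact h.wfTy_of_append_cons.weaken h.extends_of_append_cons

theorem WfCtx.weaken {R' R : RegCtx ρ} {Γ : Ctx ρ} (h : WfCtx R Γ) (hR : Extends R' R) :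
    WfCtx R' Γ :=
  ⟨hR.1, fun A hA => (h.2 A hA).weaken hR⟩

theorem WfCtx.cons {R : RegCtx ρ} {Γ : Ctx ρ} {A : Ty ρ} (h : WfCtx R Γ) (hA : WfTy R A) :
    WfCtx R (A :: Γ) :=
  ⟨h.1, by simpa using ⟨hA, h.2⟩⟩

theorem WfReg.wfCtx_nil {R : RegCtx ρ} (h : WfReg R) : WfCtx R [] := ⟨h, by simp⟩

theorem SubTy.wfTy {R : RegCtx ρ} {A A' : Ty ρ} (h : SubTy R A A') : WfTy R A ∧ WfTy R A' := by
  induction h with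
  | refl h => exact ⟨h, h⟩
  | arr _ _ he he' ihA ihB =>
    exact ⟨.arr ihA.2 ihB.1 (he.trans he'), .arr ihA.1 ihB.2 he'⟩

theorem SubTy.weaken {R' R : RegCtx ρ} {A A' : Ty ρ} (h : SubTy R A A') (hR : Extends R' R) :
    SubTy R' A A' := by
  induction h with
  | refl h => exact .refl (h.weaken hR)
  | arr _ _ he he' ihA ihB => exact .arr ihA ihB he (he'.trans hR.dom_subset)

theorem SubTyEff.weaken {R' R : RegCtx ρ} {A A' : Ty ρ} {e e' : Finset ρ}
    (h : SubTyEff R A e A' e') (hR : Extends R' R) : SubTyEff R' A e A' e' :=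
  ⟨h.1.weaken hR, h.2.1, h.2.2.trans hR.dom_subset⟩

namespace HasType

variable {R R' : RegCtx ρ} {Γ Δ : Ctx ρ} {M V : Tm ρ} {A B : Ty ρ} {e e' : Finset ρ}

theorem wf (h : HasType R Γ M A e) : WfCtx R Γ ∧ WfTy R A ∧ e ⊆ RegCtx.dom R := by
  induction h with
  | var h hi => exact ⟨h, h.2 _ (List.mem_of_getElem? hi), by simp⟩
  | region h hr => exact ⟨h, .reg h.1 hr, by simp⟩
  | star h => exact ⟨h, .one h.1, by simp⟩
  | lam _ ih =>
    obtain ⟨h1, h2, h3⟩ := ih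
    exact ⟨⟨h1.1, fun C hC => h1.2 C (List.mem_cons_of_mem _ hC)⟩,
      .arr (h1.2 _ List.mem_cons_self) h2 h3, by simp⟩
  | app _ _ ih1 ih2 =>
    obtain ⟨h1, h2, h3⟩ := ih1
    cases h2 with
    | arr hA hB he => exact ⟨h1, hB, Finset.union_subset (Finset.union_subset h3 he) ih2.2.2⟩
  | get _ ih =>
    obtain ⟨h1, h2, h3⟩ := ih
    cases h2 with
    | reg hR hr =>
      refine ⟨h1, hR.wfTy_of_mem hr, Finset.union_subset h3 ?_⟩
      simpa using RegCtx.mem_dom.2 ⟨_, hr⟩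
  | set _ _ ih1 ih2 =>
    obtain ⟨h1, h2, h3⟩ := ih1
    cases h2 with
    | reg hR hr =>
      refine ⟨h1, .one hR, Finset.union_subset (Finset.union_subset h3 ih2.2.2) ?_⟩
      simpa using RegCtx.mem_dom.2 ⟨_, hr⟩
  | sub _ hs ih => exact ⟨ih.1, hs.1.wfTy.2, hs.2.2⟩

theorem wfReg (h : HasType R Γ M A e) : WfReg R := h.wf.1.1

theorem weaken (h : HasType R Γ M A e) (hR : Extends R' R) : HasType R' Γ M A e := by
  induction h with
  | var h hi => exact .var (h.weaken hR) hi
  | region h hr => exact .region (h.weaken hR) (hR.subset hr)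
  | star h => exact .star (h.weaken hR)
  | lam _ ih => exact .lam ih
  | app _ _ ih1 ih2 => exact .app ih1 ih2
  | get _ ih => exact .get ih
  | set _ _ ih1 ih2 => exact .set ih1 ih2
  | sub _ hs ih => exact .sub ih (hs.weaken hR)

theorem mono_effect (h : HasType R Γ M A e) (he : e ⊆ e') (he' : e' ⊆ RegCtx.dom R) :
    HasType R Γ M A e' :=
  .sub h ⟨.refl h.wf.2.1, he, he'⟩

/-- Applying a pure function to a pure argument has the latent effect of the function. -/
theorem app_pure (h : HasType R Γ M (.arr A e B) ∅) (hV : HasType R Γ V A ∅) :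
    HasType R Γ (.app M V) B e := by
  simpa only [Finset.empty_union, Finset.union_empty] using h.app hV

theorem rename (h : HasType R Γ M A e) {f : ℕ → ℕ} (hΔ : WfCtx R Δ)
    (hf : ∀ i A, Γ[i]? = some A → Δ[f i]? = some A) : HasType R Δ (M.rename f) A e := by
  induction h generalizing f Δ with
  | var _ hi => exact .var hΔ (hf _ _ hi)
  | region _ hr => exact .region hΔ hr
  | star _ => exact .star hΔ
  | lam h ih =>
    refine .lam (ih (hΔ.cons (h.wf.1.2 _ List.mem_cons_self)) ?_)
    intro i C hC
    cases i with
    | zero => simpa [upRen] using hC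
    | succ i => exact hf i C (by simpa using hC)
  | app _ _ ih1 ih2 => exact .app (ih1 hΔ hf) (ih2 hΔ hf)
  | get _ ih => exact .get (ih hΔ hf)
  | set _ _ ih1 ih2 => exact .set (ih1 hΔ hf) (ih2 hΔ hf)
  | sub _ hs ih => exact .sub (ih hΔ hf) hs

theorem subst (h : HasType R Γ M A e) {σ : ℕ → Tm ρ} (hΔ : WfCtx R Δ)
    (hσ : ∀ i A, Γ[i]? = some A → HasType R Δ (σ i) A ∅) : HasType R Δ (M.subst σ) A e := by
  induction h generalizing σ Δ with
  | var _ hi => exact hσ _ _ hi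
  | region _ hr => exact .region hΔ hr
  | star _ => exact .star hΔ
  | lam h ih =>
    have hΔ' := hΔ.cons (h.wf.1.2 _ List.mem_cons_self)
    refine .lam (ih hΔ' ?_)
    intro i C hC
    cases i with
    | zero => exact .var hΔ' (by simpa using hC)
    | succ i =>
      exact (hσ i C (by simpa using hC)).rename hΔ' (fun j D hD => by simpa using hD)
  | app _ _ ih1 ih2 => exact .app (ih1 hΔ hσ) (ih2 hΔ hσ)
  | get _ ih => exact .get (ih hΔ hσ)
  | set _ _ ih1 ih2 => exact .set (ih1 hΔ hσ) (ih2 hΔ hσ)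
  | sub _ hs ih => exact .sub (ih hΔ hσ) hs

theorem subst_listSubst {Vs : List (Tm ρ)} (h : HasType R Γ M A e)
    (hVs : List.Forall₂ (fun V A => HasType R [] V A ∅) Vs Γ) :
    HasType R [] (M.subst (listSubst Vs)) A e := by
  refine h.subst h.wfReg.wfCtx_nil ?_
  clear h
  induction hVs with
  | nil => simp
  | cons hV _ ih =>
    intro i C hC
    cases i with
    | zero =>
      obtain rfl : _ = C := by simpa using hC
      simpa [listSubst] using hV
    | succ i => simpa [listSubst] using ih i C (by simpa using hC)

theorem inst (h : HasType R [B] M A e) (hV : HasType R [] V B ∅) :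
    HasType R [] (M.inst V) A e :=
  h.subst_listSubst (.cons hV .nil)

/-- Inversion for abstractions; a use of subsumption below the abstraction is absorbed by
retyping the bound variable at the smaller domain type. -/
theorem lam_inv (h : HasType R Γ (.lam M) (.arr A e B) e') : HasType R (A :: Γ) M B e := by
  generalize hN : Tm.lam M = N at h
  generalize hC : Ty.arr A e B = C at h
  induction h generalizing A e B with
  | lam h => cases hN; cases hC; exact h
  | sub h hs ih =>
    subst hC
    obtain ⟨hs, -, -⟩ := hs
    cases hs with
    | refl _ => exact ih hN rfl
    | arr hA hB he he' =>
      have h1 := ih hN rfl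
      have hΔ := h.wf.1.cons hA.wfTy.1
      refine .sub ?_ ⟨hB, he, he'⟩
      rw [← M.subst_var]
      refine h1.subst hΔ ?_
      intro i D hD
      cases i with
      | zero =>
        obtain rfl : _ = D := by simpa using hD
        exact .sub (.var hΔ rfl) ⟨hA, subset_rfl, by simp⟩
      | succ i => exact .var hΔ (by simpa using hD)
  | _ => simp_all

theorem region_inv {r s : ρ} (h : HasType R Γ (.region s) (.reg r A) e) :
    s = r ∧ (r, A) ∈ R := by
  generalize hN : Tm.region s = N at h
  generalize hC : Ty.reg r A = C at h
  induction h with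
  | region _ hr => cases hN; cases hC; exact ⟨rfl, hr⟩
  | sub h hs ih =>
    subst hC
    obtain ⟨hs, -, -⟩ := hs
    cases hs
    exact ih hN rfl
  | _ => simp_all

/-- Values are typable with the empty effect. -/
theorem value (h : HasType R Γ V A e) (hV : V.IsValue) : HasType R Γ V A ∅ := by
  induction h with
  | var h hi => exact .var h hi
  | region h hr => exact .region h hr
  | star h => exact .star h
  | lam h => exact .lam h
  | sub _ hs ih => exact .sub (ih hV) ⟨hs.1, subset_rfl, by simp⟩
  | _ => cases hV

end HasType

/-! ### Structural presentation of reduction -/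

/-- Writing leaves the store unchanged exactly when the value is already bound to the region. -/
theorem Store.add_singleton_eq_iff {S : Store ρ} {r : ρ} {V : Tm ρ}
    {h : ∀ W ∈ ({V} : Set (Tm ρ)), W.IsValue} : S.add r {V} h = S ↔ V ∈ S.contents r := by
  constructor
  · intro hS
    rw [← hS]
    exact Or.inr ⟨rfl, rfl⟩
  · intro hV
    refine Store.ext' (Finset.insert_eq_of_mem (S.mem_dom r V hV)) ?_
    funext s
    ext W
    constructor
    · rintro (hW | ⟨rfl, rfl⟩)
      · exact hW
      · exact hV
    · exact Or.inl

/-- Reduction presented by head reductions and closure under the frames of evaluation contexts. -/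
inductive Red : Tm ρ → Store ρ → Tm ρ → Store ρ → Prop
  | beta (M V : Tm ρ) (S : Store ρ) : V.IsValue → Red (.app (.lam M) V) S (M.inst V) S
  | read (r : ρ) (V : Tm ρ) (S : Store ρ) : V ∈ S.contents r → Red (.get (.region r)) S V S
  | write (r : ρ) (V : Tm ρ) (S : Store ρ) (hV : V.IsValue) :
      Red (.set (.region r) V) S .star
        (S.add r {V} (fun _ h => Set.mem_singleton_iff.mp h ▸ hV))
  | appL {M M' : Tm ρ} {S S' : Store ρ} (N : Tm ρ) :
      Red M S M' S' → Red (.app M N) S (.app M' N) S'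
  | appR {N N' : Tm ρ} {S S' : Store ρ} (V : Tm ρ) :
      V.IsValue → Red N S N' S' → Red (.app V N) S (.app V N') S'
  | get {M M' : Tm ρ} {S S' : Store ρ} : Red M S M' S' → Red (.get M) S (.get M') S'
  | setL {M M' : Tm ρ} {S S' : Store ρ} (N : Tm ρ) :
      Red M S M' S' → Red (.set M N) S (.set M' N) S'
  | setR {N N' : Tm ρ} {S S' : Store ρ} (V : Tm ρ) :
      V.IsValue → Red N S N' S' → Red (.set V N) S (.set V N') S'

theorem Red.fill {M M' : Tm ρ} {S S' : Store ρ} (h : Red M S M' S') (E : ECtx ρ) :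
    Red (E.fill M) S (E.fill M') S' := by
  induction E with
  | hole => exact h
  | appL E N ih => exact .appL N ih
  | appR V hV E ih => exact .appR V hV ih
  | get E ih => exact .get ih
  | setL E N ih => exact .setL N ih
  | setR V hV E ih => exact .setR V hV ih

theorem step_iff_red {P Q : Tm ρ × Store ρ} : Step P Q ↔ Red P.1 P.2 Q.1 Q.2 := by
  constructor
  · intro h
    cases h with
    | beta E M V S hV => exact (Red.beta M V S hV).fill E
    | get E r V S hV => exact (Red.read r V S hV).fill E
    | set E r V S hV => exact (Red.write r V S hV).fill E
  · obtain ⟨M, S⟩ := P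
    obtain ⟨M', S'⟩ := Q
    intro h
    -- The redex may be placed in any context: with this the frames found by induction compose.
    have key : ∃ (E : ECtx ρ) (N N' : Tm ρ), M = E.fill N ∧ M' = E.fill N' ∧
        ∀ F : ECtx ρ, Step (F.fill N, S) (F.fill N', S') := by
      change Red M S M' S' at h
      induction h with
      | beta M V S hV => exact ⟨.hole, _, _, rfl, rfl, fun F => .beta F M V S hV⟩
      | read r V S hV => exact ⟨.hole, _, _, rfl, rfl, fun F => .get F r V S hV⟩
      | write r V S hV => exact ⟨.hole, _, _, rfl, rfl, fun F => .set F r V S hV⟩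
      | appL N _ ih =>
        obtain ⟨E, K, K', rfl, rfl, h⟩ := ih
        exact ⟨.appL E N, K, K', rfl, rfl, h⟩
      | appR V hV _ ih =>
        obtain ⟨E, K, K', rfl, rfl, h⟩ := ih
        exact ⟨.appR V hV E, K, K', rfl, rfl, h⟩
      | get _ ih =>
        obtain ⟨E, K, K', rfl, rfl, h⟩ := ih
        exact ⟨.get E, K, K', rfl, rfl, h⟩
      | setL N _ ih =>
        obtain ⟨E, K, K', rfl, rfl, h⟩ := ih
        exact ⟨.setL E N, K, K', rfl, rfl, h⟩
      | setR V hV _ ih =>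
        obtain ⟨E, K, K', rfl, rfl, h⟩ := ih
        exact ⟨.setR V hV E, K, K', rfl, rfl, h⟩
    obtain ⟨E, K, K', rfl, rfl, hs⟩ := key
    exact hs E

theorem Tm.IsValue.not_red {V N : Tm ρ} {S S' : Store ρ} (hV : V.IsValue) : ¬ Red V S N S' := by
  intro h
  cases hV <;> cases h

/-- Reduction only enlarges the store. -/
theorem Red.store_le {M M' : Tm ρ} {S S' : Store ρ} (h : Red M S M' S') :
    S.dom ⊆ S'.dom ∧ ∀ r, S.contents r ⊆ S'.contents r := by
  induction h with
  | write r V S hV => exact ⟨Finset.subset_insert _ _, fun _ _ => Or.inl⟩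
  | _ => simp_all

/-- All values stored in a region of `R` have the type assigned to that region. -/
def StoreTyped (R : RegCtx ρ) (S : Store ρ) : Prop :=
  ∀ r A V, (r, A) ∈ R → V ∈ S.contents r → HasType R [] V A ∅

/-- Subject reduction. The new store need not be typed, because in a saturated store the
reductions of interest leave the store unchanged. -/
theorem HasType.preservation {R : RegCtx ρ} {M M' : Tm ρ} {A : Ty ρ} {e : Finset ρ}
    {S S' : Store ρ} (h : HasType R [] M A e) (hS : StoreTyped R S) (hr : Red M S M' S') :
    HasType R [] M' A e := by
  generalize hΓ : ([] : Ctx ρ) = Γ at h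
  induction h generalizing M' S' with
  | var | region | star | lam => cases hr
  | app hM hN ihM ihN =>
    subst hΓ
    cases hr with
    | beta L V S hV =>
      have h1 := hM.lam_inv.inst (hN.value hV)
      refine h1.mono_effect (fun x hx => ?_) (hM.app hN).wf.2.2
      simp [hx]
    | appL N hr => exact .app (ihM hr rfl) hN
    | appR V hV hr => exact .app hM (ihN hr rfl)
  | get hM ih =>
    subst hΓ
    cases hr with
    | read r V S hV =>
      obtain ⟨rfl, hm⟩ := hM.region_inv
      exact (hS _ _ _ hm hV).mono_effect (by simp) hM.get.wf.2.2
    | get hr => exact .get (ih hr rfl)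
  | set hM hN ihM ihN =>
    subst hΓ
    cases hr with
    | write r V S hV =>
      exact (HasType.star hM.wf.1).mono_effect (by simp) (hM.set hN).wf.2.2
    | setL N hr => exact .set (ihM hr rfl) hN
    | setR V hV hr => exact .set hM (ihN hr rfl)
  | sub _ hs ih => exact .sub (ih hr hΓ) hs

/-- A typed term only accesses the regions in its effect: its reductions can be replayed in any
store with the same contents on the effect. -/
theorem HasType.red_of_agree {R : RegCtx ρ} {Γ : Ctx ρ} {M M' : Tm ρ} {A : Ty ρ} {e : Finset ρ}
    {S S' T : Store ρ} (h : HasType R Γ M A e)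
    (hST : ∀ r ∈ e, S.contents r = T.contents r) (hr : Red M S M' S') :
    ∃ T', Red M T M' T' ∧ (S' = S ↔ T' = T) := by
  induction h generalizing M' S' with
  | var | region | star | lam => cases hr
  | app hM hN ihM ihN =>
    cases hr with
    | beta L V S hV => exact ⟨T, .beta _ _ T hV, by simp⟩
    | appL N hr =>
      obtain ⟨T', h1, h2⟩ := ihM (fun r hr => hST r (by simp [hr])) hr
      exact ⟨T', .appL _ h1, h2⟩
    | appR V hV hr =>
      obtain ⟨T', h1, h2⟩ := ihN (fun r hr => hST r (by simp [hr])) hr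
      exact ⟨T', .appR _ hV h1, h2⟩
  | get hM ih =>
    cases hr with
    | read r V S hV =>
      obtain ⟨rfl, hm⟩ := hM.region_inv
      exact ⟨T, .read r _ T (hST r (by simp) ▸ hV), by simp⟩
    | get hr =>
      obtain ⟨T', h1, h2⟩ := ih (fun r hr => hST r (by simp [hr])) hr
      exact ⟨T', .get h1, h2⟩
  | set hM hN ihM ihN =>
    cases hr with
    | write r V S hV =>
      obtain ⟨rfl, hm⟩ := hM.region_inv
      refine ⟨_, .write r _ T hV, ?_⟩
      rw [Store.add_singleton_eq_iff, Store.add_singleton_eq_iff, hST r (by simp)]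
    | setL N hr =>
      obtain ⟨T', h1, h2⟩ := ihM (fun r hr => hST r (by simp [hr])) hr
      exact ⟨T', .setL _ h1, h2⟩
    | setR V hV hr =>
      obtain ⟨T', h1, h2⟩ := ihN (fun r hr => hST r (by simp [hr])) hr
      exact ⟨T', .setR _ hV h1, h2⟩
  | sub _ hs ih => exact ih (fun r hr => hST r (hs.2.1 hr)) hr

/-! ### Convergence in a fixed store -/

/-- `M` terminates in the store `S`, no reduction changes the store, and all normal forms
satisfy `Q`. -/
inductive Converges (S : Store ρ) (Q : Tm ρ → Prop) : Tm ρ → Prop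
  | intro (M : Tm ρ) : (∀ M' S', Red M S M' S' → S' = S) →
      (∀ M', Red M S M' S → Converges S Q M') →
      ((∀ M' S', ¬ Red M S M' S') → Q M) → Converges S Q M

theorem SN.exists_conv {P : Tm ρ × Store ρ} (h : SN P) : ∃ Q, Conv P Q := by
  induction h with
  | intro P _ ih =>
    by_cases hP : ∃ Q, Step P Q
    · obtain ⟨Q, hQ⟩ := hP
      obtain ⟨N, hN, hn⟩ := ih Q hQ
      exact ⟨N, hN.head hQ, hn⟩
    · exact ⟨P, .refl, hP⟩

theorem store_le_of_reduces {P Q : Tm ρ × Store ρ} (h : Relation.ReflTransGen Step P Q) :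
    P.2.dom ⊆ Q.2.dom ∧ ∀ r, P.2.contents r ⊆ Q.2.contents r := by
  induction h with
  | refl => exact ⟨subset_rfl, fun _ => subset_rfl⟩
  | tail _ hs ih =>
    have h1 := (step_iff_red.1 hs).store_le
    exact ⟨ih.1.trans h1.1, fun r => (ih.2 r).trans (h1.2 r)⟩

/-- Since stores only grow, a store that is recovered at every normal form never changes along
the way. -/
theorem converges_iff {S : Store ρ} {Q : Tm ρ → Prop} {M : Tm ρ} :
    Converges S Q M ↔
      SN (M, S) ∧ ∀ M' S', Conv (M, S) (M', S') → S' = S ∧ Q M' := by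
  constructor
  · intro h
    induction h with
    | intro M hst _ hQ ih =>
      constructor
      · refine Acc.intro _ ?_
        rintro ⟨M', S'⟩ hs
        have hr := step_iff_red.1 hs
        obtain rfl := hst _ _ hr
        exact (ih M' hr).1
      · rintro M' S' ⟨hc, hn⟩
        rcases hc.cases_head with heq | ⟨⟨M₁, S₁⟩, hs, hc'⟩
        · cases heq
          exact ⟨rfl, hQ fun M' S' hr => hn ⟨(M', S'), step_iff_red.2 hr⟩⟩
        · have hr := step_iff_red.1 hs
          obtain rfl := hst _ _ hr
          exact (ih M₁ hr).2 M' S' ⟨hc', hn⟩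
  · rintro ⟨hsn, hc⟩
    generalize hP : (M, S) = P at hsn
    induction hsn generalizing M with
    | intro P hacc ih =>
      subst hP
      refine .intro M ?_ ?_ ?_
      · intro M' S' hr
        have hs : Step (M, S) (M', S') := step_iff_red.2 hr
        obtain ⟨⟨N, T⟩, hN, hn⟩ := SN.exists_conv (hacc _ hs)
        obtain ⟨rfl, -⟩ := hc N T ⟨hN.head hs, hn⟩
        have h1 := hr.store_le
        have h2 := store_le_of_reduces hN
        exact Store.ext' (h2.1.antisymm h1.1) (funext fun r => (h2.2 r).antisymm (h1.2 r))
      · intro M' hr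
        have hs : Step (M, S) (M', S) := step_iff_red.2 hr
        exact ih _ hs (fun N T h => hc N T ⟨h.1.head hs, h.2⟩) rfl
      · intro hn
        exact (hc M S ⟨.refl, fun ⟨Q', hQ'⟩ => hn _ _ (step_iff_red.1 hQ')⟩).2

namespace Converges

variable {S T : Store ρ} {Q Q' : Tm ρ → Prop} {M V : Tm ρ}

theorem of_value (hV : V.IsValue) (hQ : Q V) : Converges S Q V :=
  .intro V (fun _ _ h => (hV.not_red h).elim) (fun _ h => (hV.not_red h).elim) fun _ => hQ

theorem of_value_iff (hV : V.IsValue) : Converges S Q V ↔ Q V := by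
  refine ⟨fun h => ?_, of_value hV⟩
  cases h with
  | intro _ _ _ h => exact h fun _ _ => hV.not_red

theorem mono (h : Converges S Q M) (hQ : ∀ M, Q M → Q' M) : Converges S Q' M := by
  induction h with
  | intro M hst _ hn ih => exact .intro M hst ih fun h => hQ M (hn h)

/-- Evaluation of a subterm in a frame `F` of evaluation contexts. -/
theorem bind {F : Tm ρ → Tm ρ}
    (hF : ∀ {M S M' S'}, Red M S M' S' → Red (F M) S (F M') S')
    (hF' : ∀ {M S N S'}, ¬ M.IsValue → Red (F M) S N S' → ∃ M', Red M S M' S' ∧ N = F M')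
    (h : Converges S Q M) (hQ : ∀ V, Q V → Converges S Q' (F V)) : Converges S Q' (F M) := by
  induction h with
  | intro M hst _ hn ih =>
    by_cases hM : ∃ M' S', Red M S M' S'
    · obtain ⟨M', S', hr⟩ := hM
      have hv : ¬ M.IsValue := fun hv => hv.not_red hr
      refine .intro _ ?_ ?_ ?_
      · intro N S₁ hN
        obtain ⟨N', hN', -⟩ := hF' hv hN
        exact hst _ _ hN'
      · intro N hN
        obtain ⟨N', hN', rfl⟩ := hF' hv hN
        exact ih N' hN'
      · intro h
        exact (h _ _ (hF hr)).elim
    · push Not at hM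
      exact hQ M (hn hM)

theorem appL {N : Tm ρ} (h : Converges S Q M)
    (hQ : ∀ V, Q V → Converges S Q' (.app V N)) : Converges S Q' (.app M N) := by
  refine bind (F := fun M => .app M N) (fun h => .appL N h) ?_ h hQ
  intro M S K S' hv hr
  cases hr with
  | beta => exact (hv (.lam _)).elim
  | appL _ hr => exact ⟨_, hr, rfl⟩
  | appR _ h _ => exact (hv h).elim

theorem appR (hV : V.IsValue) (h : Converges S Q M)
    (hQ : ∀ W, Q W → Converges S Q' (.app V W)) : Converges S Q' (.app V M) := by
  refine bind (F := fun M => .app V M) (fun h => .appR V hV h) ?_ h hQ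
  intro M S K S' hv hr
  cases hr with
  | beta _ _ _ h => exact (hv h).elim
  | appL _ hr => exact (hV.not_red hr).elim
  | appR _ h hr => exact ⟨_, hr, rfl⟩

theorem get (h : Converges S Q M)
    (hQ : ∀ V, Q V → Converges S Q' (.get V)) : Converges S Q' (.get M) := by
  refine bind (F := fun M => .get M) (fun h => .get h) ?_ h hQ
  intro M S K S' hv hr
  cases hr with
  | read => exact (hv (.region _)).elim
  | get hr => exact ⟨_, hr, rfl⟩

theorem setL {N : Tm ρ} (h : Converges S Q M)
    (hQ : ∀ V, Q V → Converges S Q' (.set V N)) : Converges S Q' (.set M N) := by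
  refine bind (F := fun M => .set M N) (fun h => .setL N h) ?_ h hQ
  intro M S K S' hv hr
  cases hr with
  | write => exact (hv (.region _)).elim
  | setL _ hr => exact ⟨_, hr, rfl⟩
  | setR _ h _ => exact (hv h).elim

theorem setR (hV : V.IsValue) (h : Converges S Q M)
    (hQ : ∀ W, Q W → Converges S Q' (.set V W)) : Converges S Q' (.set V M) := by
  refine bind (F := fun M => .set V M) (fun h => .setR V hV h) ?_ h hQ
  intro M S K S' hv hr
  cases hr with
  | write _ _ _ h => exact (hv h).elim
  | setL _ hr => exact (hV.not_red hr).elim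
  | setR _ h hr => exact ⟨_, hr, rfl⟩

theorem beta (hV : V.IsValue) (h : Converges S Q (M.inst V)) :
    Converges S Q (.app (.lam M) V) := by
  refine .intro _ ?_ ?_ fun h => (h _ _ (.beta M V S hV)).elim
  · intro M' S' hr
    cases hr with
    | beta => rfl
    | appL _ hr => exact ((Tm.IsValue.lam _).not_red hr).elim
    | appR _ _ hr => exact (hV.not_red hr).elim
  · intro M' hr
    cases hr with
    | beta => exact h
    | appL _ hr => exact ((Tm.IsValue.lam _).not_red hr).elim
    | appR _ _ hr => exact (hV.not_red hr).elim

theorem read {r : ρ} (hne : ∃ V, V ∈ S.contents r)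
    (h : ∀ V ∈ S.contents r, Converges S Q V) : Converges S Q (.get (.region r)) := by
  obtain ⟨W, hW⟩ := hne
  refine .intro _ ?_ ?_ fun h => (h _ _ (.read r W S hW)).elim
  · intro M' S' hr
    cases hr with
    | read => rfl
    | get hr => exact ((Tm.IsValue.region _).not_red hr).elim
  · intro M' hr
    cases hr with
    | read _ _ _ hV => exact h _ hV
    | get hr => exact ((Tm.IsValue.region _).not_red hr).elim

theorem write {r : ρ} (hV : V ∈ S.contents r) (hQ : Q .star) :
    Converges S Q (.set (.region r) V) := by
  have hval := S.isValue r V hV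
  have key : ∀ M' S', Red (.set (.region r) V) S M' S' → S' = S ∧ M' = .star := by
    intro M' S' hr
    cases hr with
    | write => exact ⟨Store.add_singleton_eq_iff.2 hV, rfl⟩
    | setL _ hr => exact ((Tm.IsValue.region _).not_red hr).elim
    | setR _ _ hr => exact (hval.not_red hr).elim
  refine .intro _ (fun M' S' hr => (key M' S' hr).1) (fun M' hr => ?_)
    fun h => (h _ _ (.write r V S hval)).elim
  obtain rfl := (key M' S hr).2
  exact of_value .star hQ

/-- Convergence of a typed term only depends on the contents of the store on its effect. -/
theorem of_agree {R : RegCtx ρ} {A : Ty ρ} {e : Finset ρ} (h : Converges S Q M)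
    (hM : HasType R [] M A e) (hS : StoreTyped R S)
    (hST : ∀ r ∈ e, S.contents r = T.contents r) (hQ : ∀ M, Q M → Q' M) :
    Converges T Q' M := by
  have hTS : ∀ r ∈ e, T.contents r = S.contents r := fun r hr => (hST r hr).symm
  induction h with
  | intro M hst _ hn ih =>
    refine .intro M ?_ ?_ ?_
    · intro M' T' hr
      obtain ⟨S', hr', heq⟩ := hM.red_of_agree hTS hr
      exact heq.2 (hst _ _ hr')
    · intro M' hr
      obtain ⟨S', hr', heq⟩ := hM.red_of_agree hTS hr
      obtain rfl := heq.1 rfl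
      exact ih M' hr' (hM.preservation hS hr')
    · intro hT
      refine hQ M (hn fun M' S' hr => ?_)
      obtain ⟨T', hr', -⟩ := hM.red_of_agree hST hr
      exact hT _ _ hr'

end Converges

/-! ### Saturated stores and the interpretation of types -/

theorem mem_satStore {R R' : RegCtx ρ} {r : ρ} {V : Tm ρ} :
    V ∈ (satStore R R').contents r ↔
      ∃ L R₁ A, R = L ++ (r, A) :: R₁ ∧ V.IsValue ∧ (R', V) ∈ Interp R₁ A ∅ := by
  induction R with
  | nil => simp [satStore, Store.empty]
  | cons p R ih =>
    obtain ⟨s, B⟩ := p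
    have h : V ∈ (satStore ((s, B) :: R) R').contents r ↔
        V ∈ (satStore R R').contents r ∨ r = s ∧ V.IsValue ∧ (R', V) ∈ Interp R B ∅ := Iff.rfl
    rw [h, ih]
    clear h
    constructor
    · rintro (⟨L, R₁, A, rfl, h⟩ | ⟨rfl, h⟩)
      · exact ⟨(s, B) :: L, R₁, A, rfl, h⟩
      · exact ⟨[], R, B, rfl, h⟩
    · rintro ⟨L, R₁, A, hL, h⟩
      cases L with
      | nil => cases hL; exact Or.inr ⟨rfl, h⟩
      | cons q L => cases hL; exact Or.inl ⟨L, R₁, A, rfl, h⟩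

/-- The saturated store of an extension has the same contents on the old regions. -/
theorem satStore_append {L R R' : RegCtx ρ} (h : WfReg (L ++ R)) {r : ρ}
    (hr : r ∈ RegCtx.dom R) :
    (satStore (L ++ R) R').contents r = (satStore R R').contents r := by
  have hL := h.notMem_dom_of_append hr
  clear h
  induction L with
  | nil => rfl
  | cons p L ih =>
    obtain ⟨s, B⟩ := p
    simp only [RegCtx.dom, List.map_cons, List.toFinset_cons, Finset.mem_insert, not_or] at hL
    rw [← ih hL.2]
    ext V
    exact ⟨fun h => h.resolve_right fun h' => hL.1 h'.1, Or.inl⟩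

/-- Membership in the interpretation, with termination and the conditions on normal forms merged
into convergence in a fixed store. -/
theorem mem_interp {R R' : RegCtx ρ} {M : Tm ρ} {A : Ty ρ} {e : Finset ρ} :
    (R', M) ∈ Interp R A e ↔ Extends R' R ∧ HasType R' [] M A e ∧
      ∀ R'', Extends R'' R' →
        Converges (satStore R R'') (NormalCond R (satStore R) A R'') M := by
  simp only [converges_iff]
  constructor
  · rintro ⟨⟨h1, h2⟩, h3, h4⟩
    exact ⟨h1, h2, fun R'' h => ⟨h3 R'' h, fun M' S' hc => h4 M' S' R'' h hc⟩⟩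
  · rintro ⟨h1, h2, h3⟩
    exact ⟨⟨h1, h2⟩, fun R'' h => (h3 R'' h).1, fun M' S' R'' h hc => (h3 R'' h).2 M' S' hc⟩

theorem normalCond_arr {R R' : RegCtx ρ} {M : Tm ρ} {A B : Ty ρ} {e : Finset ρ} :
    NormalCond R (satStore R) (.arr A e B) R' M ↔ (∃ N, M = .lam N) ∧
      ∀ R₁ V, Extends R₁ R' → V.IsValue → (R₁, V) ∈ Interp R A ∅ →
        (R₁, Tm.app M V) ∈ Interp R B e := Iff.rfl

theorem NormalCond.isValue {R R' : RegCtx ρ} {M : Tm ρ} {A : Ty ρ}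
    (h : NormalCond R (satStore R) A R' M) : M.IsValue := by
  cases A with
  | one => obtain rfl : M = .star := h; exact .star
  | reg r A => obtain rfl : M = .region r := h; exact .region r
  | arr A e B => obtain ⟨⟨N, rfl⟩, -⟩ := h; exact .lam N

theorem NormalCond.weaken {R R' R'' : RegCtx ρ} {M : Tm ρ} {A : Ty ρ}
    (h : NormalCond R (satStore R) A R' M) (hR : Extends R'' R') :
    NormalCond R (satStore R) A R'' M := by
  cases A with
  | one => exact h
  | reg r A => exact h
  | arr A e B => exact ⟨h.1, fun R₁ V hR₁ => h.2 R₁ V (hR₁.trans hR)⟩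

theorem mem_interp_weaken {R R' R'' : RegCtx ρ} {M : Tm ρ} {A : Ty ρ} {e : Finset ρ}
    (h : (R', M) ∈ Interp R A e) (hR : Extends R'' R') : (R'', M) ∈ Interp R A e := by
  rw [mem_interp] at h ⊢
  exact ⟨hR.trans h.1, h.2.1.weaken hR, fun R₁ hR₁ => h.2.2 R₁ (hR₁.trans hR)⟩

/-- A value is in the interpretation as soon as it is typed and satisfies the condition on normal
forms in the present region context: that condition persists in all extensions. -/
theorem mem_interp_of_value {R R' : RegCtx ρ} {V : Tm ρ} {A : Ty ρ} {e : Finset ρ}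
    (hR : Extends R' R) (hV : HasType R' [] V A e) (hn : NormalCond R (satStore R) A R' V) :
    (R', V) ∈ Interp R A e :=
  mem_interp.2 ⟨hR, hV, fun _ hR'' => .of_value hn.isValue (hn.weaken hR'')⟩

theorem normalCond_of_mem_interp {R R' : RegCtx ρ} {V : Tm ρ} {A : Ty ρ} {e : Finset ρ}
    (hV : V.IsValue) (h : (R', V) ∈ Interp R A e) : NormalCond R (satStore R) A R' V := by
  have h' := mem_interp.1 h
  exact (Converges.of_value_iff hV).1 (h'.2.2 R' (.refl h'.1.1))

theorem storeTyped_satStore {R R' : RegCtx ρ} (h : Extends R' R) :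
    StoreTyped R' (satStore R R') := by
  intro r A V hA hV
  obtain ⟨L, R₁, B, rfl, -, hV⟩ := mem_satStore.1 hV
  obtain rfl : A = B := h.1.unique hA (h.subset (by simp))
  exact (mem_interp.1 hV).2.1

/-- A term of the interpretation evaluates to values of the interpretation with empty effect. -/
theorem converges_of_mem_interp {R R' R'' : RegCtx ρ} {M : Tm ρ} {A : Ty ρ} {e : Finset ρ}
    (h : (R', M) ∈ Interp R A e) (hR : Extends R'' R') :
    Converges (satStore R R'') (fun V => V.IsValue ∧ (R'', V) ∈ Interp R A ∅) M := by
  obtain ⟨h1, h2, h3⟩ := mem_interp.1 h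
  have hR' := hR.trans h1
  have hS := storeTyped_satStore hR'
  have hM := h2.weaken hR
  have hc := h3 R'' hR
  clear h h2 h3
  induction hc with
  | intro M hst _ hn ih =>
    refine .intro M hst (fun M' hr => ih M' hr (hM.preservation hS hr)) fun h => ?_
    have hc := hn h
    exact ⟨hc.isValue, mem_interp_of_value hR' (hM.value hc.isValue) hc⟩

/-- Stability of the interpretation of a type under extensions of the region context, given
stability of the condition on normal forms. Typed terms do not see the added regions because
their effects are contained in the smaller context. -/
theorem mem_interp_iff_of_normalCond_iff {R₁ R R' : RegCtx ρ} {M : Tm ρ} {A : Ty ρ}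
    {e : Finset ρ} (hR : Extends R R₁) (hR' : Extends R' R) (he : e ⊆ RegCtx.dom R₁)
    (hA : ∀ R'' M, Extends R'' R →
      (NormalCond R (satStore R) A R'' M ↔ NormalCond R₁ (satStore R₁) A R'' M)) :
    (R', M) ∈ Interp R A e ↔ (R', M) ∈ Interp R₁ A e := by
  have hst : ∀ R'', ∀ r ∈ e,
      (satStore R R'').contents r = (satStore R₁ R'').contents r := by
    intro R'' r hr
    obtain ⟨hw, L, rfl⟩ := hR
    exact satStore_append hw (he hr)
  rw [mem_interp, mem_interp]
  constructor
  · rintro ⟨h1, h2, h3⟩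
    refine ⟨h1.trans hR, h2, fun R'' hR'' => ?_⟩
    have h := hR''.trans hR'
    exact (h3 R'' hR'').of_agree (h2.weaken hR'') (storeTyped_satStore h) (hst R'')
      fun M => (hA R'' M h).1
  · rintro ⟨h1, h2, h3⟩
    refine ⟨hR', h2, fun R'' hR'' => ?_⟩
    have h := hR''.trans hR'
    exact (h3 R'' hR'').of_agree (h2.weaken hR'') (storeTyped_satStore (h.trans hR))
      (fun r hr => (hst R'' r hr).symm) fun M => (hA R'' M h).2

/-- The condition on normal forms does not depend on the region context over which a type is
interpreted. The latent effect of a well-formed arrow type lies in the smaller context, so the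
stability of the interpretation applies to the codomain. -/
theorem normalCond_iff_of_extends {R₁ R : RegCtx ρ} {A : Ty ρ} (hR : Extends R R₁)
    (hA : WfTy R₁ A) (R' : RegCtx ρ) (M : Tm ρ) (hR' : Extends R' R) :
    NormalCond R (satStore R) A R' M ↔ NormalCond R₁ (satStore R₁) A R' M := by
  induction A generalizing R' M with
  | one => exact Iff.rfl
  | reg r A => exact Iff.rfl
  | arr A e B ihA ihB =>
    cases hA with
    | arr hA hB he =>
      rw [normalCond_arr, normalCond_arr]
      refine and_congr_right fun _ => forall₂_congr fun R₂ V => forall₂_congr fun hR₂ _ => ?_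
      have h := hR₂.trans hR'
      rw [mem_interp_iff_of_normalCond_iff hR h (by simp) (ihA hA),
        mem_interp_iff_of_normalCond_iff hR h he (ihB hB)]

theorem mem_interp_iff_of_extends {R₁ R R' : RegCtx ρ} {M : Tm ρ} {A : Ty ρ} {e : Finset ρ}
    (hR : Extends R R₁) (hR' : Extends R' R) (hA : WfTy R₁ A) (he : e ⊆ RegCtx.dom R₁) :
    (R', M) ∈ Interp R A e ↔ (R', M) ∈ Interp R₁ A e :=
  mem_interp_iff_of_normalCond_iff hR hR' he (normalCond_iff_of_extends hR hA)

/-- The saturated store of `R` binds `r : A` to the values in the interpretation of `A` over all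
of `R`, although it is defined from the interpretation over the entries before `r`. -/
theorem mem_satStore_iff {R R' : RegCtx ρ} {r : ρ} {A : Ty ρ} {V : Tm ρ} (hR : Extends R' R)
    (hwf : WfReg R) (hr : (r, A) ∈ R) :
    V ∈ (satStore R R').contents r ↔ V.IsValue ∧ (R', V) ∈ Interp R A ∅ := by
  have key : ∀ L R₁ B, R = L ++ (r, B) :: R₁ →
      ((R', V) ∈ Interp R A ∅ ↔ (R', V) ∈ Interp R₁ B ∅) := by
    rintro L R₁ B rfl
    obtain rfl : A = B := hwf.unique hr (by simp)
    exact mem_interp_iff_of_extends hwf.extends_of_append_cons hR hwf.wfTy_of_append_cons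
      (by simp)
  rw [mem_satStore]
  constructor
  · rintro ⟨L, R₁, B, hL, hV, h⟩
    exact ⟨hV, (key L R₁ B hL).2 h⟩
  · rintro ⟨hV, h⟩
    obtain ⟨L, R₁, hL⟩ := List.append_of_mem hr
    exact ⟨L, R₁, A, hL, hV, (key L R₁ A hL).1 h⟩

/-- Subsumption for the interpretation, given subsumption for the condition on normal forms. -/
theorem mem_interp_of_normalCond_imp {R R' : RegCtx ρ} {A A' : Ty ρ} {e e' : Finset ρ} {M : Tm ρ}
    (hs : SubTyEff R A e A' e')
    (hn : ∀ R' M, NormalCond R (satStore R) A R' M → NormalCond R (satStore R) A' R' M)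
    (h : (R', M) ∈ Interp R A e) : (R', M) ∈ Interp R A' e' := by
  rw [mem_interp] at h ⊢
  exact ⟨h.1, h.2.1.sub (hs.weaken h.1), fun R'' hR'' => (h.2.2 R'' hR'').mono (hn R'')⟩

theorem normalCond_of_subTy {R : RegCtx ρ} {A A' : Ty ρ} (h : SubTy R A A') (R' : RegCtx ρ)
    (M : Tm ρ) (hn : NormalCond R (satStore R) A R' M) :
    NormalCond R (satStore R) A' R' M := by
  induction h generalizing R' M with
  | refl _ => exact hn
  | arr hA hB he he' ihA ihB =>
    refine ⟨hn.1, fun R₁ V hR₁ hV h => ?_⟩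
    exact mem_interp_of_normalCond_imp ⟨hB, he, he'⟩ ihB (hn.2 R₁ V hR₁ hV
      (mem_interp_of_normalCond_imp ⟨hA, subset_rfl, by simp⟩ ihA h))

theorem mem_interp_of_subTyEff {R R' : RegCtx ρ} {A A' : Ty ρ} {e e' : Finset ρ} {M : Tm ρ}
    (hs : SubTyEff R A e A' e') (h : (R', M) ∈ Interp R A e) : (R', M) ∈ Interp R A' e' :=
  mem_interp_of_normalCond_imp hs (normalCond_of_subTy hs.1) h

/-- Closure of the interpretation under head expansion. -/
theorem mem_interp_beta {R R' : RegCtx ρ} {B : Ty ρ} {e : Finset ρ} {M V : Tm ρ}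
    (hV : V.IsValue) (ht : HasType R' [] (.app (.lam M) V) B e)
    (h : (R', M.inst V) ∈ Interp R B e) : (R', Tm.app (.lam M) V) ∈ Interp R B e := by
  rw [mem_interp] at h ⊢
  exact ⟨h.1, ht, fun R'' hR'' => (h.2.2 R'' hR'').beta hV⟩

theorem inhabitant_hasType {R : RegCtx ρ} {Γ : Ctx ρ} {A : Ty ρ} (hA : WfTy R A)
    (hΓ : WfCtx R Γ) : HasType R Γ (inhabitant A) A ∅ := by
  induction A generalizing Γ with
  | one => exact .star hΓ
  | reg => cases hA with | reg _ h => exact .region hΓ h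
  | arr A e B _ ihB =>
    cases hA with
    | arr hA hB he => exact .lam ((ihB hB (hΓ.cons hA)).mono_effect (by simp) he)

/-- Every well-formed type is inhabited by a value, so that reading a region of a saturated store
never gets stuck. -/
theorem inhabitant_mem_interp {R R' : RegCtx ρ} {A : Ty ρ} (hA : WfTy R A)
    (hR : Extends R' R) : (R', inhabitant A) ∈ Interp R A ∅ := by
  induction A generalizing R' with
  | one => exact mem_interp_of_value hR (inhabitant_hasType (hA.weaken hR) hR.1.wfCtx_nil) rfl
  | reg => exact mem_interp_of_value hR (inhabitant_hasType (hA.weaken hR) hR.1.wfCtx_nil) rfl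
  | arr A e B _ ihB =>
    have ht := inhabitant_hasType (hA.weaken hR) hR.1.wfCtx_nil
    refine mem_interp_of_value hR ht ⟨⟨_, rfl⟩, fun R₁ V hR₁ hV h => ?_⟩
    cases hA with
    | arr hA hB he =>
      have h' := mem_interp.1 h
      refine mem_interp_beta hV ?_ ?_
      · exact (ht.weaken hR₁).app_pure h'.2.1
      · rw [Tm.inst, inhabitant_subst]
        exact mem_interp_of_subTyEff ⟨.refl hB, by simp, he⟩ (ihB hB h'.1)

/-! ### Soundness -/

theorem mem_interp_app {R R' : RegCtx ρ} {M N : Tm ρ} {A B : Ty ρ} {e₁ e₂ e₃ : Finset ρ}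
    (hM : (R', M) ∈ Interp R (.arr A e₂ B) e₁) (hN : (R', N) ∈ Interp R A e₃) :
    (R', Tm.app M N) ∈ Interp R B (e₁ ∪ e₂ ∪ e₃) := by
  have hM' := mem_interp.1 hM
  refine mem_interp.2 ⟨hM'.1, hM'.2.1.app (mem_interp.1 hN).2.1, fun R'' hR => ?_⟩
  have hwf := Extends.refl hR.1
  refine (converges_of_mem_interp hM hR).appL fun V hV => ?_
  refine (converges_of_mem_interp hN hR).appR hV.1 fun W hW => ?_
  have h := (normalCond_of_mem_interp hV.1 hV.2).2 R'' W hwf hW.1 hW.2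
  exact (mem_interp.1 h).2.2 R'' hwf

/-- A value read from the saturated store is in the interpretation by `mem_satStore_iff`, and
there is one to read by `inhabitant_mem_interp`. -/
theorem mem_interp_get {R R' : RegCtx ρ} {M : Tm ρ} {r : ρ} {A : Ty ρ} {e : Finset ρ}
    (hA : WfTy R (.reg r A)) (hM : (R', M) ∈ Interp R (.reg r A) e) :
    (R', Tm.get M) ∈ Interp R A (e ∪ {r}) := by
  have hM' := mem_interp.1 hM
  refine mem_interp.2 ⟨hM'.1, hM'.2.1.get, fun R'' hR => ?_⟩
  cases hA with
  | reg hwf hr =>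
    have hR₀ := hR.trans hM'.1
    have hmem := fun V => mem_satStore_iff (V := V) hR₀ hwf hr
    refine (hM'.2.2 R'' hR).get fun V hV => ?_
    obtain rfl : V = .region r := hV
    refine .read ⟨inhabitant A, (hmem _).2 ⟨inhabitant_isValue A,
      inhabitant_mem_interp (hwf.wfTy_of_mem hr) hR₀⟩⟩ fun V hV => ?_
    exact (mem_interp.1 ((hmem V).1 hV).2).2.2 R'' (.refl hR.1)

/-- The value written is already bound to `r` in the saturated store, so the store is kept. -/
theorem mem_interp_set {R R' : RegCtx ρ} {M N : Tm ρ} {r : ρ} {A : Ty ρ} {e₁ e₂ : Finset ρ}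
    (hA : WfTy R (.reg r A)) (hM : (R', M) ∈ Interp R (.reg r A) e₁)
    (hN : (R', N) ∈ Interp R A e₂) :
    (R', Tm.set M N) ∈ Interp R .one (e₁ ∪ e₂ ∪ {r}) := by
  have hM' := mem_interp.1 hM
  refine mem_interp.2 ⟨hM'.1, hM'.2.1.set (mem_interp.1 hN).2.1, fun R'' hR => ?_⟩
  cases hA with
  | reg hwf hr =>
    refine (hM'.2.2 R'' hR).setL fun V hV => ?_
    obtain rfl : V = .region r := hV
    refine (converges_of_mem_interp hN hR).setR (.region r) fun W hW => ?_
    exact .write ((mem_satStore_iff (hR.trans hM'.1) hwf hr).2 hW) rfl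

theorem HasType.valid {R : RegCtx ρ} {Γ : Ctx ρ} {M : Tm ρ} {B : Ty ρ} {e : Finset ρ}
    (h : HasType R Γ M B e) : Valid R Γ M B e := by
  induction h with
  | @var Γ i A h hi =>
    intro R' Vs hR hVs
    obtain ⟨hiΓ, rfl⟩ := List.getElem?_eq_some_iff.1 hi
    have hiVs : i < Vs.length := hVs.length_eq ▸ hiΓ
    simpa [Tm.subst, listSubst, hiVs] using (hVs.get hiVs hiΓ).2
  | region h hr =>
    intro R' Vs hR hVs
    exact mem_interp_of_value hR (.region hR.1.wfCtx_nil (hR.subset hr)) rfl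
  | star h =>
    intro R' Vs hR hVs
    exact mem_interp_of_value hR (.star hR.1.wfCtx_nil) rfl
  | @lam Γ M A B e h ih =>
    intro R' Vs hR hVs
    have ht : HasType R' [] ((Tm.lam M).subst (listSubst Vs)) (.arr A e B) ∅ :=
      (h.lam.weaken hR).subst_listSubst (hVs.imp fun V C hV => (mem_interp.1 hV.2).2.1)
    refine mem_interp_of_value hR ht ⟨⟨_, rfl⟩, fun R₁ V hR₁ hV hVA => ?_⟩
    refine mem_interp_beta hV ?_ ?_
    · exact (ht.weaken hR₁).app_pure (mem_interp.1 hVA).2.1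
    · rw [Tm.inst_subst_upSubst]
      exact ih R₁ (V :: Vs) (hR₁.trans hR) (.cons ⟨hV, hVA⟩
        (hVs.imp fun W C hW => ⟨hW.1, mem_interp_weaken hW.2 hR₁⟩))
  | app _ _ ihM ihN =>
    exact fun R' Vs hR hVs => mem_interp_app (ihM R' Vs hR hVs) (ihN R' Vs hR hVs)
  | get hM ih => exact fun R' Vs hR hVs => mem_interp_get hM.wf.2.1 (ih R' Vs hR hVs)
  | set hM _ ihM ihN =>
    exact fun R' Vs hR hVs => mem_interp_set hM.wf.2.1 (ihM R' Vs hR hVs) (ihN R' Vs hR hVs)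
  | sub _ hs ih => exact fun R' Vs hR hVs => mem_interp_of_subTyEff hs (ih R' Vs hR hVs)

end StratRegions

theorem mainTheorem1 {ρ : Type*} [DecidableEq ρ] (R : StratRegions.RegCtx ρ)
    (Γ : StratRegions.Ctx ρ) (M : StratRegions.Tm ρ) (B : StratRegions.Ty ρ) (e : Finset ρ)
    (h : StratRegions.HasType R Γ M B e) :
    StratRegions.Valid R Γ M B e :=
  h.valid
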